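/- Let $I$ be a nonempty set, let $S$ be a semigroup, and let $E$ be a real, strictly convex, reflexive and smooth Banach space (smooth: $\lim_{t\to0}(\|x+ty\|-\|x\|)/t$ exists for all unit vectors $x,y$). For each $i\in I$ let $C_i\subseteq E$ be nonempty, compact and convex, and let $\mathcal S_i=\{T_{s,i}:s\in S\}$ be a family of nonexpansive maps $T_{s,i}:C_i\to C_i$ with $T_{st,i}=T_{s,i}T_{t,i}$ for all $s,t\in S$, such that $\mathrm{Fix}(\mathcal S_i)=\bigcap_{s\in S}\{x\in C_i:T_{s,i}x=x\}\neq\emptyset$. Let $B(S)$ be the space of bounded real-valued functions on $S$ with the supremum norm, with left translations $(l_sf)(t)=f(st)$. Let $X\subseteq B(S)$ be a linear subspace with $1\in X$ and $l_s(X)\subseteq X$ for all $s\in S$, which contains the function $t\mapsto\langle T_{t,i}x,x^*\rangle$ for all $i\in I$, $x\in C_i$, $x^*\in E^*$. Let $(\mu_n)$ be a sequence of means on $X$ (that is, $\mu_n\in X^*$ and $\|\mu_n\|=\mu_n(1)=1$) that is left regular: $\lim_n\|l_s^*\mu_n-\mu_n\|=0$ for each $s\in S$. For each $i\in I$ let $f_i:C_i\to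 C_i$ be an $\alpha_i$-contraction with $0\le\alpha_i<1$, i.e. $\|f_i(x)-f_i(y)\|\le\alpha_i\|x-y\|$, and let $(\epsilon_n)$ be a sequence in $(0,1)$ with $\lim_n\epsilon_n=0$. Then: 1. For all $n$, $i$ and $x\in C_i$ there is a unique vector $T_{\mu_n,i}x\in E$ such that $\langle T_{\mu_n,i}x,x^*\rangle=\mu_n\big(t\mapsto\langle T_{t,i}x,x^*\rangle\big)$ for all $x^*\in E^*$, and it belongs to $C_i$. 2. For all $n$ and $i$ there is a unique $z_{n,i}\in C_i$ with $$z_{n,i}=\epsilon_nf_i(z_{n,i})+(1-\epsilon_n)T_{\mu_n,i}z_{n,i}.$$ 3. For each $i$ there is a unique sunny nonexpansive retraction $P_i$ of $C_i$ onto $\mathrm{Fix}(\mathcal S_i)$, that is, a unique nonexpansive map $P_i:C_i\to\mathrm{Fix}(\mathcal S_i)$ with $P_ix=x$ for $x\in\mathrm{Fix}(\mathcal S_i)$ and $P_i(P_ix+t(x-P_ix))=P_ix$ whenever $x\in C_i$, $t\ge0$ and $P_ix+t(x-P_ix)\in C_i$. 4. For each $i$ there is a unique $x_i\in C_i$ with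 $f_i(P_ix_i)=x_i$. 5. The functions $g_n:I\to E$, $g_n(i)=z_{n,i}$, converge to the function $g:I\to E$, $g(i)=P_ix_i$, in the product topology on $E^I$, where each factor $E$ carries its norm topology. -/

import Mathlib

open Filter Topology
open scoped ENNReal NNReal

noncomputable section

/-- A real normed space is reflexive if the canonical embedding into its bidual is onto. -/
def IsReflexiveSpace (E : Type*) [NormedAddCommGroup E] [NormedSpace ℝ E] : Prop :=
  Function.Surjective (NormedSpace.inclusionInDoubleDual ℝ E)

/-- A real normed space is smooth if its norm is Gateaux differentiable at each unit vector. -/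
def IsSmoothSpace (E : Type*) [NormedAddCommGroup E] [NormedSpace ℝ E] : Prop :=
  ∀ x y : E, ‖x‖ = 1 → ‖y‖ = 1 →
    ∃ l : ℝ, Tendsto (fun t : ℝ => (‖x + t • y‖ - ‖x‖) / t) (𝓝[≠] 0) (𝓝 l)

/-- `B(S)`: the bounded real-valued functions on `S` with the supremum norm. -/
abbrev BddFun (S : Type*) : Type _ := lp (fun _ : S => ℝ) ∞

/-- Left translation on `B(S)`: `(l_s f)(t) = f (s t)`. -/
def leftTranslate {S : Type*} [Semigroup S] (s : S) : BddFun S →L[ℝ] BddFun S :=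
  LinearMap.mkContinuous
    { toFun := fun f => ⟨fun t => f (s * t), memℓp_infty (by
        obtain ⟨c, hc⟩ := (lp.memℓp f).bddAbove
        refine ⟨c, ?_⟩
        rintro _ ⟨t, rfl⟩
        exact hc ⟨s * t, rfl⟩)⟩
      map_add' := fun _ _ => rfl
      map_smul' := fun _ _ => rfl }
    1 (fun f => by
      rw [one_mul]
      exact lp.norm_le_of_forall_le (norm_nonneg f)
        (fun t => lp.norm_apply_le_norm ENNReal.top_ne_zero f (s * t)))

theorem leftTranslate_apply {S : Type*} [Semigroup S] (s t : S) (f : BddFun S) :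
    leftTranslate s f t = f (s * t) := rfl

/-- `X` is left invariant: `l_s X ⊆ X` for each `s`. -/
def IsLeftInvariant {S : Type*} [Semigroup S] (X : Submodule ℝ (BddFun S)) : Prop :=
  ∀ s : S, ∀ f ∈ X, leftTranslate s f ∈ X

/-- A mean on a subspace `X` of `B(S)` that contains the constant function `1`. -/
def IsMean {S : Type*} {X : Submodule ℝ (BddFun S)} (h1 : (1 : BddFun S) ∈ X)
    (μ : StrongDual ℝ X) : Prop :=
  ‖μ‖ = 1 ∧ μ ⟨1, h1⟩ = 1

/-- The adjoint `l_s^* : X^* → X^*` of left translation on a left invariant subspace `X`. -/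
def leftTranslateAdjoint {S : Type*} [Semigroup S] {X : Submodule ℝ (BddFun S)}
    (hX : IsLeftInvariant X) (s : S) (μ : StrongDual ℝ X) : StrongDual ℝ X :=
  μ.comp (((leftTranslate s).comp X.subtypeL).codRestrict X (fun f => hX s f f.2))

/-- A sequence `μ` in `X^*` is left regular if `‖l_s^* μ_n - μ_n‖ → 0` for each `s`. -/
def IsLeftRegularSeq {S : Type*} [Semigroup S] {X : Submodule ℝ (BddFun S)}
    (hX : IsLeftInvariant X) (μ : ℕ → StrongDual ℝ X) : Prop :=
  ∀ s : S, Tendsto (fun n => ‖leftTranslateAdjoint hX s (μ n) - μ n‖) atTop (𝓝 0)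

/-- `v = ∫ f(t) dμ(t)` weakly: for each functional `x'` on `E`, the function `t ↦ ⟨f t, x'⟩`
belongs to `X` and `⟨v, x'⟩` is the value of `μ` at it. -/
def IsMeanIntegral {S E : Type*} [NormedAddCommGroup E] [NormedSpace ℝ E]
    {X : Submodule ℝ (BddFun S)} (μ : StrongDual ℝ X) (f : S → E) (v : E) : Prop :=
  ∀ x' : StrongDual ℝ E, ∃ φ : X, (∀ t : S, (φ : BddFun S) t = x' (f t)) ∧ x' v = μ φ

/-- Such a vector is unique, since functionals separate points. -/
theorem IsMeanIntegral.unique {S E : Type*} [NormedAddCommGroup E] [NormedSpace ℝ E]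
    {X : Submodule ℝ (BddFun S)} {μ : StrongDual ℝ X} {f : S → E} {v w : E}
    (hv : IsMeanIntegral μ f v) (hw : IsMeanIntegral μ f w) : v = w := by
  refine (SeparatingDual.eq_iff_forall_dual_eq (R := ℝ)).2 fun x' => ?_
  obtain ⟨φ, hφ, h⟩ := hv x'
  obtain ⟨ψ, hψ, h'⟩ := hw x'
  have : φ = ψ := by
    ext t
    rw [hφ, hψ]
  rw [h, h', this]

open Classical in
/-- The vector `∫ f(t) dμ(t)` (and `0` if there is none). -/
def meanIntegral {S E : Type*} [NormedAddCommGroup E] [NormedSpace ℝ E]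
    {X : Submodule ℝ (BddFun S)} (μ : StrongDual ℝ X) (f : S → E) : E :=
  if h : ∃ v, IsMeanIntegral μ f v then h.choose else 0

/-- A representation of the semigroup `S` as nonexpansive mappings from `C` into itself. -/
structure IsNonexpansiveRepresentation {S E : Type*} [Semigroup S] [NormedAddCommGroup E]
    {C : Set E} (T : S → C → C) : Prop where
  map_mul : ∀ (s t : S) (x : C), T (s * t) x = T s (T t x)
  nonexpansive : ∀ s : S, LipschitzWith 1 (T s)

/-- The set of common fixed points of a family of self-maps of `C`. -/
def commonFix {S E : Type*} {C : Set E} (T : S → C → C) : Set C :=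
  ⋂ s, {x | T s x = x}

/-- `T_μ x = ∫ T_t x dμ(t)`, as a vector of `E`. -/
def meanMap {S E : Type*} [NormedAddCommGroup E] [NormedSpace ℝ E] {C : Set E}
    {X : Submodule ℝ (BddFun S)} (T : S → C → C) (μ : StrongDual ℝ X) (x : C) : E :=
  meanIntegral μ (fun t => (T t x : E))

/-- `P` is a sunny nonexpansive retraction of `C` onto its subset `D`. -/
structure IsSunnyNonexpansiveRetraction {E : Type*} [NormedAddCommGroup E] [NormedSpace ℝ E]
    {C : Set E} (D : Set C) (P : C → C) : Prop where
  mem : ∀ x, P x ∈ D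
  fix : ∀ x ∈ D, P x = x
  nonexpansive : LipschitzWith 1 P
  sunny : ∀ (x y : C) (t : ℝ), 0 ≤ t → (y : E) = (P x : E) + t • ((x : E) - (P x : E)) →
    P y = P x

end

/-! The theorem concerns each index separately, so fix one set `C`, its representation `T` with
common fixed point set `F`, and a contraction `f`.

The mean integral `T_μ x` is represented by a vector because `E` is reflexive, and that vector lies
in `C` because a mean is monotone and hyperplanes separate points from `C`
(`exists_isMeanIntegral`). Since `T_μ` is nonexpansive, the implicit scheme is the fixed point
equation of a contraction (`existsUnique_implicit`).

Two facts govern the limit points `w` of the solutions `z_n`. First, `w ∈ F`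
(`mem_commonFix_of_tendsto`): one has `T_{μ_n} w → w`, so for `p ∈ F` and a functional `j` norming
`w - p`, left regularity makes the means of `t ↦ j (T_t w)` and `t ↦ j (T_s T_t w)` both tend to the
maximum `j w`; strict convexity then leaves `T_s w = w` as the only possibility. Second, moving from
`z_n` towards `f z_n` does not decrease the distance to any point of `F`
(`IsMeanIntegral.norm_le_of_implicit`), and as this inequality involves only norms it passes to the
limit: `w` is the sunny point for `f w` (`IsSunnyPoint`).

Smoothness enters through `IsSunnyPoint.dist_le`: sunny points for `u` depend nonexpansively on `u`. Hence they are unique, `u ↦ w` for constant `f = u` is the unique sunny nonexpansive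
retraction `P` onto `F`, and for a contraction `f` the point `w` is unique. As `P x` with
`f (P x) = x` is the sunny point for `f (P x)`, every limit point of `z_n` equals `P x`, and
compactness gives convergence.
-/

/-! ### Norming functionals -/

section NormedSpace

variable {E : Type*} [NormedAddCommGroup E] [NormedSpace ℝ E]

theorem StrongDual.apply_le_norm {j : StrongDual ℝ E} (hj : ‖j‖ ≤ 1) (x : E) : j x ≤ ‖x‖ :=
  (le_abs_self _).trans ((j.le_of_opNorm_le hj x).trans_eq (one_mul _))

/-- In a strictly convex space a functional that norms `b` attains its maximum over the ball of
radius `‖b‖` only at `b`. -/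
theorem eq_of_apply_eq_norm [StrictConvexSpace ℝ E] {j : StrongDual ℝ E} (hj : ‖j‖ ≤ 1) {a b : E}
    (hb : j b = ‖b‖) (hab : ‖a‖ ≤ ‖b‖) (ha : j a = ‖b‖) : a = b := by
  have h1 := StrongDual.apply_le_norm hj (a + b)
  have h2 := StrongDual.apply_le_norm hj a
  have h3 := norm_add_le a b
  rw [map_add] at h1
  exact eq_of_norm_eq_of_norm_add_eq (by linarith) (by linarith)

/-- If the norm does not decrease from `x ≠ 0` in the direction `w`, then in a smooth space the
functional norming `x` is nonnegative at `w`: its value there is the two-sided directional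
derivative of the norm, which is nonnegative from the right. -/
theorem IsSmoothSpace.apply_nonneg (hsmooth : IsSmoothSpace E) {x w : E} {j : StrongDual ℝ E}
    (hj : ‖j‖ ≤ 1) (hx : j x = ‖x‖) (hx0 : x ≠ 0) (h : ∀ t : ℝ, 0 ≤ t → ‖x‖ ≤ ‖x + t • w‖) :
    0 ≤ j w := by
  rcases eq_or_ne w 0 with rfl | hw
  · simp
  have hxn : 0 < ‖x‖ := norm_pos_iff.2 hx0
  have hwn : 0 < ‖w‖ := norm_pos_iff.2 hw
  have hx1 : ‖‖x‖⁻¹ • x‖ = 1 := norm_smul_inv_norm (𝕜 := ℝ) hx0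
  obtain ⟨l, hl⟩ := hsmooth (‖x‖⁻¹ • x) (‖w‖⁻¹ • w) hx1 (norm_smul_inv_norm (𝕜 := ℝ) hw)
  rw [hx1] at hl
  have hl0 : 0 ≤ l := by
    refine ge_of_tendsto (hl.mono_left (nhdsGT_le_nhdsNE 0)) ?_
    filter_upwards [self_mem_nhdsWithin] with t ht
    have ht : 0 < t := ht
    refine div_nonneg (sub_nonneg.2 ?_) ht.le
    have key := h (‖x‖ * (t * ‖w‖⁻¹)) (by positivity)
    have e : ‖x‖⁻¹ • x + t • ‖w‖⁻¹ • w = ‖x‖⁻¹ • (x + (‖x‖ * (t * ‖w‖⁻¹)) • w) := by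
      rw [smul_add, smul_smul ‖x‖⁻¹ (_ * _), inv_mul_cancel_left₀ hxn.ne', smul_smul]
    rw [e, norm_smul, norm_inv, norm_norm, ← inv_mul_cancel₀ hxn.ne']
    gcongr
  have hlj : l ≤ j (‖w‖⁻¹ • w) := by
    refine le_of_tendsto (hl.mono_left (nhdsLT_le_nhdsNE 0)) ?_
    filter_upwards [self_mem_nhdsWithin] with t ht
    have ht : t < 0 := ht
    rw [div_le_iff_of_neg ht]
    have key := StrongDual.apply_le_norm hj (‖x‖⁻¹ • x + t • ‖w‖⁻¹ • w)
    rw [map_add, map_smul j ‖x‖⁻¹, map_smul j t, hx, smul_eq_mul, smul_eq_mul,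
      inv_mul_cancel₀ hxn.ne'] at key
    linarith
  have := hl0.trans hlj
  rw [map_smul, smul_eq_mul] at this
  exact nonneg_of_mul_nonneg_right this (inv_pos.2 hwn)

end NormedSpace

/-! ### Means and mean integrals -/

section Mean

variable {S : Type*} {X : Submodule ℝ (BddFun S)}

/-- A mean is monotone: `c` bounds from above the mean of a function that is at most `c`. -/
theorem IsMean.apply_le {h1 : (1 : BddFun S) ∈ X} {μ : StrongDual ℝ X} (hμ : IsMean h1 μ)
    {φ : X} {c : ℝ} (h : ∀ t, (φ : BddFun S) t ≤ c) : μ φ ≤ c := by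
  -- The radius `r` is so large that `φ` takes its values in the ball `[c - 2r, c]`.
  set r : ℝ := ‖(φ : BddFun S)‖ + |c| with hr
  have hr0 : 0 ≤ r := by positivity
  have hn : ‖φ - (c - r) • (⟨1, h1⟩ : X)‖ ≤ r := by
    refine lp.norm_le_of_forall_le hr0 fun t => ?_
    have e : ((φ - (c - r) • (⟨1, h1⟩ : X) : X) : BddFun S) t = (φ : BddFun S) t - (c - r) := by
      change (φ : BddFun S) t - (c - r) * 1 = _
      rw [mul_one]
    refine (congrArg norm e).trans_le ?_
    rw [Real.norm_eq_abs, abs_le]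
    have h2 := (abs_le.1 (lp.norm_apply_le_norm ENNReal.top_ne_zero (φ : BddFun S) t)).1
    have h3 := le_abs_self c
    constructor <;> linarith [h t]
  have h4 := StrongDual.apply_le_norm hμ.1.le (φ - (c - r) • (⟨1, h1⟩ : X))
  rw [map_sub, map_smul, hμ.2, smul_eq_mul, mul_one] at h4
  linarith

variable {E : Type*} [NormedAddCommGroup E] [NormedSpace ℝ E]

theorem IsMeanIntegral.apply_eq {μ : StrongDual ℝ X} {u : S → E} {v : E}
    (hv : IsMeanIntegral μ u v) {x' : StrongDual ℝ E} {φ : X}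
    (hφ : ∀ t, (φ : BddFun S) t = x' (u t)) : x' v = μ φ := by
  obtain ⟨ψ, hψ, h⟩ := hv x'
  have : φ = ψ := by
    ext t
    rw [hφ, hψ]
  rw [h, this]

theorem IsMeanIntegral.meanIntegral_eq {μ : StrongDual ℝ X} {u : S → E} {v : E}
    (hv : IsMeanIntegral μ u v) : meanIntegral μ u = v := by
  have h : ∃ v, IsMeanIntegral μ u v := ⟨v, hv⟩
  rw [meanIntegral, dif_pos h]
  exact h.choose_spec.unique hv

theorem IsMeanIntegral.norm_sub_le {h1 : (1 : BddFun S) ∈ X} {μ : StrongDual ℝ X}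
    (hμ : IsMean h1 μ) {u u' : S → E} {v v' : E} (hv : IsMeanIntegral μ u v)
    (hv' : IsMeanIntegral μ u' v') {c : ℝ} (h : ∀ t, ‖u t - u' t‖ ≤ c) : ‖v - v'‖ ≤ c := by
  obtain ⟨j, hj, hjv⟩ := exists_dual_vector'' ℝ (v - v')
  obtain ⟨φ, hφ, e⟩ := hv j
  obtain ⟨φ', hφ', e'⟩ := hv' j
  have : ‖v - v'‖ = μ (φ - φ') := by
    rw [map_sub, ← e, ← e', ← map_sub]
    exact hjv.symm
  rw [this]
  refine hμ.apply_le fun t => ?_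
  calc ((φ - φ' : X) : BddFun S) t = j (u t - u' t) := by rw [map_sub, ← hφ, ← hφ']; rfl
    _ ≤ c := (StrongDual.apply_le_norm hj _).trans (h t)

theorem isMeanIntegral_const {h1 : (1 : BddFun S) ∈ X} {μ : StrongDual ℝ X} (hμ : IsMean h1 μ)
    (v : E) : IsMeanIntegral μ (fun _ => v) v := fun x' =>
  ⟨x' v • ⟨1, h1⟩, fun t => by simp, by rw [map_smul, hμ.2, smul_eq_mul, mul_one]⟩

/-- In a reflexive space, a function with values in a bounded closed convex set `C` has a mean
integral in `C`: reflexivity represents `x' ↦ μ (x' ∘ u)` by a vector, which no hyperplane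
separates from `C`. -/
theorem exists_isMeanIntegral (hrefl : IsReflexiveSpace E) {h1 : (1 : BddFun S) ∈ X}
    {μ : StrongDual ℝ X} (hμ : IsMean h1 μ) {C : Set E} (hb : Bornology.IsBounded C)
    (hcl : IsClosed C) (hconv : Convex ℝ C) {u : S → E} (hu : ∀ t, u t ∈ C)
    (huX : ∀ x' : StrongDual ℝ E, ∃ φ ∈ X, ∀ t, φ t = x' (u t)) :
    ∃ v ∈ C, IsMeanIntegral μ u v := by
  obtain ⟨R, hR0, hR⟩ := hb.exists_pos_norm_le
  choose Φ hΦX hΦ using huX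
  let L : StrongDual ℝ (StrongDual ℝ E) := LinearMap.mkContinuous
    { toFun := fun x' => μ ⟨Φ x', hΦX x'⟩
      map_add' := fun x' y' => by
        rw [← map_add]
        congr 1
        ext t
        simp [hΦ]
      map_smul' := fun c x' => by
        rw [RingHom.id_apply, ← map_smul]
        congr 1
        ext t
        simp [hΦ] }
    R (fun x' => by
      refine (μ.le_of_opNorm_le hμ.1.le _).trans ?_
      rw [one_mul]
      refine lp.norm_le_of_forall_le (by positivity) fun t => ?_
      refine (congrArg norm (hΦ x' t)).trans_le ((x'.le_opNorm _).trans ?_)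
      rw [mul_comm]
      gcongr
      exact hR _ (hu t))
  obtain ⟨v, hv⟩ := hrefl L
  have hvL (x' : StrongDual ℝ E) : x' v = μ ⟨Φ x', hΦX x'⟩ := by
    rw [← NormedSpace.dual_def, hv]
    rfl
  refine ⟨v, ?_, fun x' => ⟨⟨Φ x', hΦX x'⟩, hΦ x', hvL x'⟩⟩
  by_contra hvC
  obtain ⟨x', c, hlt, hc⟩ := geometric_hahn_banach_closed_point hconv hcl hvC
  refine hc.not_ge ?_
  rw [hvL]
  exact hμ.apply_le fun t => (hΦ x' t).trans_le (hlt _ (hu t)).le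

end Mean

/-! ### A variational inequality for sunny retractions -/

section Sunny

variable {E : Type*} [NormedAddCommGroup E] [NormedSpace ℝ E] {C : Set E}

/-- `z` is a sunny point of `D` for `u`: it lies in `D`, and moving from `z` along the ray through
`u` never brings it closer to a point of `D` than it was at the start. With `J` the duality mapping of a smooth space
this is the variational inequality `⟨u - z, J (z - y)⟩ ≥ 0` for `y ∈ D`, in a form that involves
only norms and so passes to limits. -/
def IsSunnyPoint (D : Set C) (u z : C) : Prop :=
  z ∈ D ∧ ∀ y ∈ D, ∀ t : ℝ, 0 ≤ t → ‖(z : E) - y‖ ≤ ‖(z : E) - y + t • ((u : E) - z)‖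

/-- Adding the variational inequalities of the two points, tested against each other. -/
theorem IsSunnyPoint.dist_le (hsmooth : IsSmoothSpace E) {D : Set C} {u z u' z' : C}
    (h : IsSunnyPoint D u z) (h' : IsSunnyPoint D u' z') : dist z z' ≤ dist u u' := by
  rcases eq_or_ne z z' with rfl | hne
  · simp
  rw [Subtype.dist_eq, Subtype.dist_eq, dist_eq_norm, dist_eq_norm]
  have hne' : (z : E) - z' ≠ 0 := sub_ne_zero.2 fun e => hne (Subtype.ext e)
  obtain ⟨j, hj, hjz⟩ := exists_dual_vector'' ℝ ((z : E) - z')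
  have hjz : j ((z : E) - z') = ‖(z : E) - z'‖ := hjz
  have a1 : 0 ≤ j ((u : E) - z) := hsmooth.apply_nonneg hj hjz hne' (h.2 z' h'.1)
  have a2 : 0 ≤ (-j) ((u' : E) - z') := by
    refine hsmooth.apply_nonneg (x := (z' : E) - z) (by rwa [norm_neg]) ?_ ?_ (h'.2 z h.1)
    · rw [neg_apply, ← map_neg, neg_sub, hjz, norm_sub_rev]
    · rwa [← neg_sub, neg_ne_zero]
  have a3 := StrongDual.apply_le_norm hj ((u : E) - u')
  rw [neg_apply] at a2
  rw [← hjz]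
  simp only [map_sub] at *
  linarith

theorem IsSunnyPoint.unique (hsmooth : IsSmoothSpace E) {D : Set C} {u z z' : C}
    (h : IsSunnyPoint D u z) (h' : IsSunnyPoint D u z') : z = z' :=
  dist_le_zero.1 ((h.dist_le hsmooth h').trans_eq (dist_self u))

/-- For a contraction `f`, at most one `z` is a sunny point for its own image `f z`. -/
theorem IsSunnyPoint.unique_of_contracting (hsmooth : IsSmoothSpace E) {D : Set C} {K : ℝ≥0}
    {f : C → C} (hf : ContractingWith K f) {z z' : C} (h : IsSunnyPoint D (f z) z)
    (h' : IsSunnyPoint D (f z') z') : z = z' := by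
  have h1 := (h.dist_le hsmooth h').trans (hf.toLipschitzWith.dist_le_mul z z')
  have h2 : (K : ℝ) < 1 := hf.1
  have h3 := dist_nonneg (x := z) (y := z')
  exact dist_le_zero.1 (by nlinarith)

theorem isSunnyPoint_self {D : Set C} {x : C} (hx : x ∈ D) : IsSunnyPoint D x x :=
  ⟨hx, fun y _ t _ => by simp⟩

theorem IsSunnyNonexpansiveRetraction.isSunnyPoint (hconv : Convex ℝ C) {D : Set C} {P : C → C}
    (hP : IsSunnyNonexpansiveRetraction D P) (x : C) : IsSunnyPoint D x (P x) := by
  refine ⟨hP.mem x, fun y hy t ht => ?_⟩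
  -- For `t ≤ 1` the moved point is in `C`, and `P` maps it back to `P x`.
  have small (t : ℝ) (ht : 0 ≤ t) (ht1 : t ≤ 1) :
      ‖(P x : E) - y‖ ≤ ‖(P x : E) - y + t • ((x : E) - P x)‖ := by
    let q : C := ⟨(P x : E) + t • ((x : E) - P x),
      hconv.add_smul_sub_mem (P x).2 x.2 ⟨ht, ht1⟩⟩
    have h1 := hP.nonexpansive.dist_le_mul q y
    rw [hP.sunny x q t ht rfl, hP.fix y hy, NNReal.coe_one, one_mul, Subtype.dist_eq,
      Subtype.dist_eq, dist_eq_norm, dist_eq_norm] at h1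
    rwa [sub_add_eq_add_sub]
  rcases le_total t 1 with ht1 | ht1
  · exact small t ht ht1
  -- For `t ≥ 1` the case `t = 1` extends by convexity of the norm.
  have h1 := small 1 zero_le_one le_rfl
  set a := (P x : E) - y
  set w := (x : E) - P x
  have h2 : ‖t • (a + (1 : ℝ) • w)‖ ≤ ‖(t - 1) • a‖ + ‖a + t • w‖ := by
    refine (norm_add_le _ _).trans' (le_of_eq ?_)
    congr 1
    module
  rw [norm_smul, norm_smul, Real.norm_of_nonneg ht, Real.norm_of_nonneg (sub_nonneg.2 ht1)] at h2
  nlinarith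

theorem isSunnyNonexpansiveRetraction_of_isSunnyPoint (hsmooth : IsSmoothSpace E) {D : Set C}
    {P : C → C} (hP : ∀ x, IsSunnyPoint D x (P x)) : IsSunnyNonexpansiveRetraction D P where
  mem x := (hP x).1
  fix x hx := (hP x).unique hsmooth (isSunnyPoint_self hx)
  nonexpansive := LipschitzWith.mk_one fun x y => (hP x).dist_le hsmooth (hP y)
  sunny x y t ht hy := by
    refine (hP y).unique hsmooth ⟨(hP x).1, fun q hq s hs => ?_⟩
    rw [hy, add_sub_cancel_left, smul_smul]
    exact (hP x).2 q hq _ (by positivity)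

end Sunny

/-! ### The implicit scheme -/

section Scheme

variable {S E : Type*} [NormedAddCommGroup E] [NormedSpace ℝ E] {C : Set E}
  {X : Submodule ℝ (BddFun S)} {h1 : (1 : BddFun S) ∈ X} {T : S → C → C}

theorem meanMap_mem (hrefl : IsReflexiveSpace E) (hC : IsCompact C) (hconv : Convex ℝ C)
    (hTX : ∀ (x : C) (x' : StrongDual ℝ E), ∃ φ ∈ X, ∀ t : S, φ t = x' (T t x : E))
    {μ : StrongDual ℝ X} (hμ : IsMean h1 μ) (x : C) :
    IsMeanIntegral μ (fun t => (T t x : E)) (meanMap T μ x) ∧ meanMap T μ x ∈ C := by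
  obtain ⟨v, hvC, hv⟩ := exists_isMeanIntegral hrefl hμ hC.isBounded hC.isClosed hconv
    (fun t => (T t x).2) (hTX x)
  have e : meanMap T μ x = v := hv.meanIntegral_eq
  rw [e]
  exact ⟨hv, hvC⟩

variable [Semigroup S]

theorem IsNonexpansiveRepresentation.norm_sub_le (hT : IsNonexpansiveRepresentation T)
    {μ : StrongDual ℝ X} (hμ : IsMean h1 μ) {x y : C} {v w : E}
    (hv : IsMeanIntegral μ (fun t => (T t x : E)) v)
    (hw : IsMeanIntegral μ (fun t => (T t y : E)) w) : ‖v - w‖ ≤ ‖(x : E) - y‖ := by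
  refine hv.norm_sub_le hμ hw fun t => ?_
  simpa [Subtype.dist_eq, dist_eq_norm] using (hT.nonexpansive t).dist_le_mul x y

theorem existsUnique_implicit (hrefl : IsReflexiveSpace E) (hne : C.Nonempty) (hC : IsCompact C)
    (hconv : Convex ℝ C) (hT : IsNonexpansiveRepresentation T)
    (hTX : ∀ (x : C) (x' : StrongDual ℝ E), ∃ φ ∈ X, ∀ t : S, φ t = x' (T t x : E))
    {μ : StrongDual ℝ X} (hμ : IsMean h1 μ) {K : ℝ≥0} {f : C → C} (hf : ContractingWith K f)
    {ε : ℝ} (hε : ε ∈ Set.Ioo (0 : ℝ) 1) :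
    ∃! z : C, (z : E) = ε • (f z : E) + (1 - ε) • meanMap T μ z := by
  have hM := meanMap_mem hrefl hC hconv hTX hμ
  have hε1 : 0 ≤ 1 - ε := sub_nonneg.2 hε.2.le
  let G : C → C := fun x => ⟨ε • (f x : E) + (1 - ε) • meanMap T μ x,
    hconv (f x).2 (hM x).2 hε.1.le hε1 (by ring)⟩
  let q : ℝ≥0 := ⟨ε * K + (1 - ε), by have := hε.1; positivity⟩
  have hq : q < 1 := by
    have : (K : ℝ) < 1 := hf.1
    rw [← NNReal.coe_lt_coe]
    change ε * K + (1 - ε) < 1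
    nlinarith [hε.1]
  have hG : ContractingWith q G := by
    refine ⟨hq, LipschitzWith.of_dist_le_mul fun x y => ?_⟩
    have e : (G x : E) - G y =
        ε • ((f x : E) - f y) + (1 - ε) • (meanMap T μ x - meanMap T μ y) := by
      simp only [G]
      module
    have h2 := hT.norm_sub_le hμ (hM x).1 (hM y).1
    have h3 := hf.toLipschitzWith.dist_le_mul x y
    rw [Subtype.dist_eq, Subtype.dist_eq, dist_eq_norm, dist_eq_norm] at h3 ⊢
    rw [e]
    refine (norm_add_le _ _).trans ?_
    rw [norm_smul, norm_smul, Real.norm_of_nonneg hε.1.le, Real.norm_of_nonneg hε1]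
    change _ ≤ (ε * K + (1 - ε)) * _
    rw [add_mul, mul_assoc]
    have := hε.1.le
    gcongr
  have : CompactSpace C := isCompact_iff_compactSpace.1 hC
  have : Nonempty C := hne.to_subtype
  refine ⟨hG.fixedPoint, congrArg Subtype.val hG.fixedPoint_isFixedPt.symm, fun y hy => ?_⟩
  exact hG.fixedPoint_unique (Subtype.ext hy.symm)

/-- A solution of the implicit scheme satisfies the variational inequality against common fixed
points `y`: a functional norming `z - y` does not increase from `z` to `v = T_μ z`, since `T_μ`
is nonexpansive and fixes `y`, and `f z - z` is a negative multiple of `v - z`. -/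
theorem IsMeanIntegral.norm_le_of_implicit (hT : IsNonexpansiveRepresentation T)
    {μ : StrongDual ℝ X} (hμ : IsMean h1 μ) {z u y : C} (hy : y ∈ commonFix T) {v : E}
    (hv : IsMeanIntegral μ (fun t => (T t z : E)) v) {ε : ℝ} (hε : ε ∈ Set.Ioo (0 : ℝ) 1)
    (hz : (z : E) = ε • (u : E) + (1 - ε) • v) {t : ℝ} (ht : 0 ≤ t) :
    ‖(z : E) - y‖ ≤ ‖(z : E) - y + t • ((u : E) - z)‖ := by
  have hy' (t : S) : T t y = y := Set.mem_iInter.1 hy t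
  have hvy : ‖v - y‖ ≤ ‖(z : E) - y‖ := by
    refine hT.norm_sub_le hμ hv ?_
    simpa only [hy'] using isMeanIntegral_const hμ (y : E)
  obtain ⟨j, hj, hjz⟩ := exists_dual_vector'' ℝ ((z : E) - y)
  have hjz : j ((z : E) - y) = ‖(z : E) - y‖ := hjz
  have h2 := (StrongDual.apply_le_norm hj (v - y)).trans (hvy.trans_eq hjz.symm)
  have h3 : ε * j ((u : E) - z) = (1 - ε) * j ((z : E) - v) := by
    rw [← smul_eq_mul, ← smul_eq_mul, ← map_smul, ← map_smul]
    congr 1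
    have : ε • (u : E) = z - (1 - ε) • v := eq_sub_of_add_eq hz.symm
    rw [smul_sub, this]
    module
  have h4 : 0 ≤ j ((u : E) - z) := by
    refine nonneg_of_mul_nonneg_right (h3 ▸ mul_nonneg (sub_nonneg.2 hε.2.le) ?_) hε.1
    simp only [map_sub] at h2 ⊢
    linarith
  have h5 := StrongDual.apply_le_norm hj ((z : E) - y + t • ((u : E) - z))
  rw [map_add, map_smul, hjz, smul_eq_mul] at h5
  nlinarith

/-- If `T_{μ_n} z → z` along a left regular sequence of means, then `z` is a common fixed point.
For a common fixed point `p` and a functional `j` norming `z - p`, the means force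
`j (T_t z) + j (T_s T_t z)` to come arbitrarily close to its upper bound `2 j z`, which by strict
convexity is attained only if `T_t z = z = T_s z`. -/
theorem mem_commonFix_of_tendsto [StrictConvexSpace ℝ E] (hC : IsCompact C)
    (hT : IsNonexpansiveRepresentation T) (hFix : (commonFix T).Nonempty)
    (hX : IsLeftInvariant X) {μ : ℕ → StrongDual ℝ X} (hμ : ∀ n, IsMean h1 (μ n))
    (hreg : IsLeftRegularSeq hX μ) {z : C} {v : ℕ → E}
    (hv : ∀ n, IsMeanIntegral (μ n) (fun t => (T t z : E)) (v n))
    (hlim : Tendsto v atTop (𝓝 (z : E))) : z ∈ commonFix T := by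
  obtain ⟨p, hp⟩ := hFix
  have hp' (t : S) : T t p = p := Set.mem_iInter.1 hp t
  have hTp (s : S) (x : C) : ‖(T s x : E) - p‖ ≤ ‖(x : E) - p‖ := by
    simpa [Subtype.dist_eq, dist_eq_norm, hp'] using (hT.nonexpansive s).dist_le_mul x p
  refine Set.mem_iInter.2 fun s => ?_
  change T s z = z
  by_contra hne
  obtain ⟨j, hj, hjz⟩ := exists_dual_vector'' ℝ ((z : E) - p)
  have hjz : j ((z : E) - p) = ‖(z : E) - p‖ := hjz
  have hle {x : C} (hx : ‖(x : E) - p‖ ≤ ‖(z : E) - p‖) : j x ≤ j z := by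
    have := (StrongDual.apply_le_norm hj _).trans (hx.trans_eq hjz.symm)
    simpa only [map_sub, sub_le_sub_iff_right] using this
  have heq {x : C} (hx : ‖(x : E) - p‖ ≤ ‖(z : E) - p‖) (hxz : j x = j z) : x = z := by
    refine Subtype.ext (sub_left_injective (eq_of_apply_eq_norm hj hjz hx ?_))
    rw [← hjz, map_sub, map_sub, hxz]
  have : CompactSpace C := isCompact_iff_compactSpace.1 hC
  have hcont : Continuous fun x : C => j (x : E) + j (T s x : E) := by
    have := (hT.nonexpansive s).continuous
    fun_prop
  have hclosed : IsClosed {x : C | ‖(x : E) - p‖ ≤ ‖(z : E) - p‖} :=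
    isClosed_le (by fun_prop) continuous_const
  obtain ⟨a, ha, hmax⟩ := hclosed.isCompact.exists_isMaxOn ⟨z, le_refl ‖(z : E) - p‖⟩
    hcont.continuousOn
  have ha : ‖(a : E) - p‖ ≤ ‖(z : E) - p‖ := ha
  have hlt : j a + j (T s a) < j z + j z := by
    have b1 := hle ha
    have b2 := hle ((hTp s a).trans ha)
    by_contra! hge
    have e1 := heq ha (by linarith)
    have e2 := heq ((hTp s a).trans ha) (by linarith)
    rw [e1] at e2
    exact hne e2
  refine hlt.not_ge ?_
  obtain ⟨φ, hφ, -⟩ := hv 0 j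
  let ψ : X := ⟨leftTranslate s φ, hX s φ φ.2⟩
  have lim1 : Tendsto (fun n => μ n φ) atTop (𝓝 (j z)) := by
    refine ((j.continuous.tendsto _).comp hlim).congr fun n => ?_
    exact (hv n).apply_eq hφ
  have lim2 : Tendsto (fun n => μ n ψ - μ n φ) atTop (𝓝 0) := by
    refine squeeze_zero_norm (fun n => ?_) (by simpa using (hreg s).mul_const ‖φ‖)
    exact (leftTranslateAdjoint hX s (μ n) - μ n).le_opNorm φ
  have lim3 : Tendsto (fun n => μ n (φ + ψ)) atTop (𝓝 (j z + j z)) := by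
    simpa [two_mul, add_assoc] using (lim1.add lim1).add lim2
  refine le_of_tendsto' lim3 fun n => (hμ n).apply_le fun t => ?_
  calc ((φ + ψ : X) : BddFun S) t = j (T t z) + j (T s (T t z)) := by
        rw [← hT.map_mul, ← hφ, ← hφ]
        rfl
    _ ≤ _ := hmax (hTp t z)

/-- Solutions of the implicit scheme subconverge to a common fixed point `w` that is the sunny
point for `f w`. -/
theorem exists_subseq_tendsto_isSunnyPoint [StrictConvexSpace ℝ E] (hrefl : IsReflexiveSpace E)
    (hC : IsCompact C) (hconv : Convex ℝ C)
    (hT : IsNonexpansiveRepresentation T) (hFix : (commonFix T).Nonempty)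
    (hX : IsLeftInvariant X)
    (hTX : ∀ (x : C) (x' : StrongDual ℝ E), ∃ φ ∈ X, ∀ t : S, φ t = x' (T t x : E))
    {μ : ℕ → StrongDual ℝ X} (hμ : ∀ n, IsMean h1 (μ n)) (hreg : IsLeftRegularSeq hX μ)
    {f : C → C} (hf : Continuous f)
    {ε : ℕ → ℝ} (hε : ∀ n, ε n ∈ Set.Ioo (0 : ℝ) 1) (hεlim : Tendsto ε atTop (𝓝 0))
    {z : ℕ → C}
    (hz : ∀ n, (z n : E) = ε n • (f (z n) : E) + (1 - ε n) • meanMap T (μ n) (z n)) :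
    ∃ (w : C) (k : ℕ → ℕ), Tendsto (fun n => z (k n)) atTop (𝓝 w) ∧
      IsSunnyPoint (commonFix T) (f w) w := by
  have : CompactSpace C := isCompact_iff_compactSpace.1 hC
  obtain ⟨w, k, hk, hlim⟩ := CompactSpace.tendsto_subseq z
  have hlim : Tendsto (fun n => z (k n)) atTop (𝓝 w) := hlim
  have hM (n : ℕ) := meanMap_mem hrefl hC hconv hTX (hμ n)
  have zlim : Tendsto (fun n => (z (k n) : E)) atTop (𝓝 (w : E)) :=
    (continuous_subtype_val.tendsto w).comp hlim
  have flim : Tendsto (fun n => (f (z (k n)) : E)) atTop (𝓝 (f w : E)) :=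
    ((continuous_subtype_val.comp hf).tendsto w).comp hlim
  have εlim : Tendsto (fun n => ε (k n)) atTop (𝓝 0) := hεlim.comp hk.tendsto_atTop
  -- The scheme, solved for `T_{μ_n} z_n`.
  have vlim : Tendsto (fun n => meanMap T (μ (k n)) (z (k n))) atTop (𝓝 (w : E)) := by
    have l1 := ((tendsto_const_nhds (x := (1 : ℝ))).sub εlim).inv₀ (by norm_num)
    have l2 := l1.smul (zlim.sub (εlim.smul flim))
    rw [zero_smul, sub_zero, sub_zero, inv_one, one_smul] at l2
    refine l2.congr fun n => ?_
    rw [sub_eq_of_eq_add' (hz (k n)), inv_smul_smul₀ (sub_pos.2 (hε _).2).ne']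
  have wlim : Tendsto (fun n => meanMap T (μ (k n)) w) atTop (𝓝 (w : E)) := by
    have l1 : Tendsto (fun n => ‖(w : E) - z (k n)‖) atTop (𝓝 0) := by
      simpa using ((tendsto_const_nhds (x := (w : E))).sub zlim).norm
    have l2 : Tendsto (fun n => meanMap T (μ (k n)) w - meanMap T (μ (k n)) (z (k n))) atTop
        (𝓝 0) :=
      squeeze_zero_norm (fun n => hT.norm_sub_le (hμ _) (hM _ w).1 (hM _ _).1) l1
    simpa using l2.add vlim
  have hw : w ∈ commonFix T :=
    mem_commonFix_of_tendsto hC hT hFix hX (fun n => hμ (k n))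
      (fun s => (hreg s).comp hk.tendsto_atTop) (fun n => (hM (k n) w).1) wlim
  refine ⟨w, k, hlim, hw, fun y hy t ht => ?_⟩
  refine le_of_tendsto_of_tendsto' (zlim.sub_const (y : E)).norm
    ((zlim.sub_const (y : E)).add ((flim.sub zlim).const_smul t)).norm fun n => ?_
  exact (hM _ _).1.norm_le_of_implicit hT (hμ _) hy (hε _) (hz _) ht

theorem exists_isSunnyPoint [StrictConvexSpace ℝ E] (hrefl : IsReflexiveSpace E)
    (hne : C.Nonempty) (hC : IsCompact C) (hconv : Convex ℝ C)
    (hT : IsNonexpansiveRepresentation T) (hFix : (commonFix T).Nonempty)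
    (hX : IsLeftInvariant X)
    (hTX : ∀ (x : C) (x' : StrongDual ℝ E), ∃ φ ∈ X, ∀ t : S, φ t = x' (T t x : E))
    {μ : ℕ → StrongDual ℝ X} (hμ : ∀ n, IsMean h1 (μ n)) (hreg : IsLeftRegularSeq hX μ)
    {ε : ℕ → ℝ} (hε : ∀ n, ε n ∈ Set.Ioo (0 : ℝ) 1) (hεlim : Tendsto ε atTop (𝓝 0)) (u : C) :
    ∃ w, IsSunnyPoint (commonFix T) u w := by
  have hf : ContractingWith 0 (fun _ : C => u) := ⟨zero_lt_one, LipschitzWith.const u⟩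
  choose z hz _ using fun n =>
    existsUnique_implicit hrefl hne hC hconv hT hTX (hμ n) hf (hε n)
  obtain ⟨w, -, -, hw⟩ := exists_subseq_tendsto_isSunnyPoint hrefl hC hconv hT hFix hX hTX hμ hreg
    continuous_const hε hεlim hz
  exact ⟨w, hw⟩

end Scheme

/-! ### The convergence theorem -/

theorem theorem3p1 {I S E : Type*} [Nonempty I] [Semigroup S]
    [NormedAddCommGroup E] [NormedSpace ℝ E] [CompleteSpace E] [StrictConvexSpace ℝ E]
    (hrefl : IsReflexiveSpace E) (hsmooth : IsSmoothSpace E)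
    (C : I → Set E) (hCne : ∀ i, (C i).Nonempty) (hCcpt : ∀ i, IsCompact (C i))
    (hCconv : ∀ i, Convex ℝ (C i))
    (T : ∀ i, S → C i → C i) (hT : ∀ i, IsNonexpansiveRepresentation (T i))
    (hFix : ∀ i, (commonFix (T i)).Nonempty)
    (X : Submodule ℝ (BddFun S)) (hX : IsLeftInvariant X) (h1 : (1 : BddFun S) ∈ X)
    (hTX : ∀ (i : I) (x : C i) (x' : StrongDual ℝ E),
      ∃ φ ∈ X, ∀ t : S, φ t = x' (T i t x : E))
    (μ : ℕ → StrongDual ℝ X) (hμ : ∀ n, IsMean h1 (μ n)) (hreg : IsLeftRegularSeq hX μ)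
    (α : I → ℝ≥0) (f : ∀ i, C i → C i) (hf : ∀ i, ContractingWith (α i) (f i))
    (ε : ℕ → ℝ) (hε : ∀ n, ε n ∈ Set.Ioo (0 : ℝ) 1) (hεlim : Tendsto ε atTop (𝓝 0)) :
    -- the mappings `T_{μ_n,i}` are well defined and map `C_i` into itself
    (∀ n i (x : C i), IsMeanIntegral (μ n) (fun t => (T i t x : E)) (meanMap (T i) (μ n) x) ∧
      meanMap (T i) (μ n) x ∈ C i) ∧
    -- the implicit scheme has exactly one solution in `C_i`
    (∀ n i, ∃! z : C i,
      (z : E) = ε n • (f i z : E) + (1 - ε n) • meanMap (T i) (μ n) z) ∧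
    -- there is exactly one sunny nonexpansive retraction onto the common fixed point set
    (∀ i, ∃! P : C i → C i, IsSunnyNonexpansiveRetraction (commonFix (T i)) P) ∧
    ∀ P : ∀ i, C i → C i,
      (∀ i, IsSunnyNonexpansiveRetraction (commonFix (T i)) (P i)) →
      (∀ i, ∃! x : C i, f i (P i x) = x) ∧
      ∀ (x : ∀ i, C i) (z : ℕ → ∀ i, C i),
        (∀ i, f i (P i (x i)) = x i) →
        (∀ n i, (z n i : E) =
          ε n • (f i (z n i) : E) + (1 - ε n) • meanMap (T i) (μ n) (z n i)) →
        -- convergence in the product topology on `E^I`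
        Tendsto (fun n => (fun i => (z n i : E) : I → E)) atTop
          (𝓝 (fun i => (P i (x i) : E))) := by
  have sunny (i : I) (u : C i) : ∃ w, IsSunnyPoint (commonFix (T i)) u w :=
    exists_isSunnyPoint hrefl (hCne i) (hCcpt i) (hCconv i) (hT i) (hFix i) hX (hTX i) hμ hreg
      hε hεlim u
  refine ⟨fun n i x => meanMap_mem hrefl (hCcpt i) (hCconv i) (hTX i) (hμ n) x,
    fun n i => existsUnique_implicit hrefl (hCne i) (hCcpt i) (hCconv i) (hT i) (hTX i) (hμ n)
      (hf i) (hε n), fun i => ?_, fun P hP => ⟨fun i => ?_, fun x z hx hz => ?_⟩⟩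
  · choose P hP using sunny i
    refine ⟨P, isSunnyNonexpansiveRetraction_of_isSunnyPoint hsmooth hP, fun Q hQ => ?_⟩
    exact funext fun u => (hQ.isSunnyPoint (hCconv i) u).unique hsmooth (hP u)
  · have : CompactSpace (C i) := isCompact_iff_compactSpace.1 (hCcpt i)
    have : Nonempty (C i) := (hCne i).to_subtype
    have hfP : ContractingWith (α i) (f i ∘ P i) :=
      ⟨(hf i).1, by simpa using (hf i).toLipschitzWith.comp (hP i).nonexpansive⟩
    exact ⟨hfP.fixedPoint, hfP.fixedPoint_isFixedPt, fun y hy => hfP.fixedPoint_unique hy⟩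
  · refine tendsto_pi_nhds.2 fun i => ?_
    refine (continuous_subtype_val.tendsto (P i (x i))).comp ?_
    refine tendsto_of_subseq_tendsto fun ns hns => ?_
    obtain ⟨w, k, hk, hw⟩ := exists_subseq_tendsto_isSunnyPoint hrefl (hCcpt i) (hCconv i) (hT i)
      (hFix i) hX (hTX i) (fun n => hμ (ns n)) (fun s => (hreg s).comp hns)
      (hf i).toLipschitzWith.continuous (fun n => hε (ns n)) (hεlim.comp hns)
      (fun n => hz (ns n) i)
    have hPx : IsSunnyPoint (commonFix (T i)) (f i (P i (x i))) (P i (x i)) := by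
      rw [hx i]
      exact (hP i).isSunnyPoint (hCconv i) (x i)
    refine ⟨k, ?_⟩
    rw [hPx.unique_of_contracting hsmooth (hf i) hw]
    exact hk
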